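/- All graphs are finite, simple and undirected. For a graph $G$ let $n(G)$ be its number of vertices and $i(G)$ its number of isolated vertices. A set $M$ of edges of $G$ is an induced matching if no two distinct edges in $M$ have a common endvertex and no edge of $G$ joins two distinct edges in $M$; the strong matching number $\nu_s(G)$ is the maximum number of edges that form an induced matching of $G$. Let $C_5^2$ be the graph on $10$ vertices obtained from the $5$-cycle by replacing every vertex by an independent set of order $2$, where two vertices are adjacent if and only if the vertices of the $5$-cycle that they replace are adjacent, and let $n_5(G)$ be the number of connected components of $G$ that are isomorphic to $C_5^2$. Theorem. If $G$ is a graph of maximum degree at most $4$, then $$\nu_s(G)\geq \frac{n(G)-i(G)-n_5(G)}{9}.$$ In particular, if $G$ has no isolated vertices and no component isomorphic to $C_5^2$, then $\nu_s(G)\geq \frac{n(G)}{9}$. -/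

import Mathlib

namespace SimpleGraph

/-- A set `M` of edges of `G` is an induced matching if no two distinct edges in `M` have a common
endvertex and no edge of `G` joins two distinct edges in `M`. -/
def IsInducedMatching {V : Type*} (G : SimpleGraph V) (M : Finset (Sym2 V)) : Prop :=
  (∀ e ∈ M, e ∈ G.edgeSet) ∧
    ∀ e ∈ M, ∀ f ∈ M, e ≠ f → ∀ u ∈ e, ∀ v ∈ f, u ≠ v ∧ ¬ G.Adj u v

/-- The strong matching number of a finite graph: the maximum number of edges that form an
induced matching. -/
noncomputable def strongMatchingNumber {V : Type*} [Finite V] (G : SimpleGraph V) : ℕ :=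
  sSup {k : ℕ | ∃ M : Finset (Sym2 V), G.IsInducedMatching M ∧ M.card = k}

/-- The supremum defining the strong matching number is a maximum. -/
theorem isGreatest_strongMatchingNumber {V : Type*} [Finite V] (G : SimpleGraph V) :
    IsGreatest {k : ℕ | ∃ M : Finset (Sym2 V), G.IsInducedMatching M ∧ M.card = k}
      G.strongMatchingNumber := by
  have hne : {k : ℕ | ∃ M : Finset (Sym2 V), G.IsInducedMatching M ∧ M.card = k}.Nonempty :=
    ⟨0, ∅, ⟨by simp, by simp⟩, rfl⟩
  have hb : BddAbove {k : ℕ | ∃ M : Finset (Sym2 V), G.IsInducedMatching M ∧ M.card = k} := by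
    have := Fintype.ofFinite (Sym2 V)
    refine ⟨Fintype.card (Sym2 V), ?_⟩
    rintro k ⟨M, -, rfl⟩
    exact Finset.card_le_univ M
  exact ⟨Nat.sSup_mem hne hb, fun k hk => le_csSup hb hk⟩

/-- The graph `C_5^2`: every vertex of the 5-cycle is replaced by an independent set of order 2,
and two vertices are adjacent exactly when the vertices they replace are adjacent in the cycle. -/
def blownUpFiveCycle : SimpleGraph (Fin 5 × Fin 2) :=
  (cycleGraph 5).comap Prod.fst

/-- The component `C` of `G` is isomorphic to `C_5^2`. -/
def ConnectedComponent.IsBlownUpFiveCycle {V : Type*} {G : SimpleGraph V}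
    (C : G.ConnectedComponent) : Prop :=
  Nonempty (C.toSimpleGraph ≃g blownUpFiveCycle)

/-- `n_5(G)`: the number of components of `G` that are isomorphic to `C_5^2`. -/
noncomputable def numBlownUpFiveCycles {V : Type*} [Finite V] (G : SimpleGraph V) : ℕ :=
  Nat.card {C : G.ConnectedComponent // C.IsBlownUpFiveCycle}

/-- `i(G)`: the number of isolated vertices of `G`. -/
noncomputable def numIsolated {V : Type*} [Finite V] (G : SimpleGraph V) : ℕ :=
  Nat.card {v : V // G.IsIsolated v}

end SimpleGraph

/-!
The bound is reached greedily. If an edge `uv` is taken into the matching and `N(u) ∪ N(v)` is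
deleted, the number of non-isolated vertices drops by the order of this set plus the number of
vertices that become isolated; call `uv` cheap if this is at most `9`. Since `C_5^2` is
`4`-regular, every induced copy of it in a graph of maximum degree at most `4` is a component, so
deletions create no new copies. Deleting one vertex from each component isomorphic to `C_5^2`
destroys all copies and isolates no vertex (`card_le_strongMatchingNumber`). It remains to see
that a graph of maximum degree at most `4` with an edge and without an induced `C_5^2` has a cheap
edge (`exists_card_dominated_add_card_stranded_le`).

This is a local statement. If `uv` is not cheap, then, as `N(u) ∪ N(v)` has at most `8` vertices,
at least two vertices outside have all their neighbours inside, and even more if `u` and `v` have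
small degrees or common neighbours. When this is required of all edges, the graph closes up
quickly: starting from a vertex of minimum positive degree `δ` and branching either on the
neighbourhood of a vertex or on a vertex isolated by an edge that is not cheap, one meets a cheap
edge on every branch, except on one for `δ = 4`, which ends in `C_5^2` itself. Exchanging vertices
with the same known neighbours cuts the case distinction down to fewer than `300` nodes.

The case distinction is carried out by evaluating a verified search. `PartialGraph` records what
is known about a neighbourhood of the root, `PartialGraph.Realizes` says that a graph contains
such a configuration, `PartialGraph.Realizes.exists_child` and `PartialGraph.Realizes.not_refuted`
say that branching is exhaustive and that discarded cases do not occur, and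
`PartialGraph.exists_run_star` evaluates the search for `δ = 1, 2, 3, 4`.
-/

/-! ### Partial graphs and the search -/

/-- A partially explored graph on the vertices `0, 1, …, length - 1`. The entry at `i` is the list
of the neighbours of `i` found so far, with a flag saying that this list is complete. Nothing is
assumed about pairs of vertices without the flag that are not listed as adjacent. -/
abbrev PartialGraph := List (Bool × List ℕ)

namespace PartialGraph

/-- The known neighbours of `i`; empty if `i` is not a vertex. -/
def nb (s : PartialGraph) (i : ℕ) : List ℕ := (s.getD i (false, [])).2

/-- Whether all neighbours of `i` are known; false if `i` is not a vertex. -/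
def closed (s : PartialGraph) (i : ℕ) : Bool := (s.getD i (false, [])).1

/-- Append `n` vertices about which nothing is known. -/
def addVertices (s : PartialGraph) (n : ℕ) : PartialGraph := s ++ List.replicate n (false, [])

/-- Make `x` adjacent to all of `T` and declare its neighbourhood complete. -/
def join (s : PartialGraph) (x : ℕ) (T : List ℕ) : PartialGraph :=
  (List.range s.length).map fun i =>
    (s.closed i || i == x, s.nb i ++ (bif i == x then T else bif T.contains i then [x] else []))

/-- The known vertices adjacent to `i` or `j`, listed without repetition. -/
def edgeNbhd (s : PartialGraph) (i j : ℕ) : List ℕ :=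
  s.nb i ++ (s.nb j).filter fun a => !(s.nb i).contains a

/-- The vertices outside `N` whose known neighbours all lie in `N`. -/
def enclosed (s : PartialGraph) (N : List ℕ) : List ℕ :=
  (List.range s.length).filter fun x => !N.contains x && (s.nb x).all N.contains

/-- The number of edges that may still be added at vertices of `N` when degrees are at most `4`.
-/
def slots (s : PartialGraph) (N : List ℕ) : ℕ :=
  (N.map fun a => if s.closed a then 0 else 4 - (s.nb a).length).sum

/-- For closed adjacent `i` and `j`, this test shows that deleting `N(i) ∪ N(j)` destroys at most
`9` non-isolated vertices in every graph of minimum positive degree `δ` extending `s`: a vertex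
isolated by the deletion is either already an enclosed vertex, or it is unknown and takes at least
`δ` of the free slots. -/
def refutes (δ : ℕ) (s : PartialGraph) (i j : ℕ) : Bool :=
  let N := s.edgeNbhd i j
  Nat.ble (N.length + (s.enclosed N).length + s.slots N / δ) 9

/-- Whether some edge with closed ends is refuted. The order in which edges are tried affects only
the time of evaluation. -/
def refuted (δ : ℕ) (s : PartialGraph) : Bool :=
  (List.range s.length).reverse.any fun i => s.closed i &&
    (s.nb i).any fun j => Nat.blt i j && s.closed j && s.refutes δ i j

/-- Vertices `p` and `q` have the same known neighbours, apart from each other. -/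
def twins (s : PartialGraph) (p q : ℕ) : Bool :=
  ((s.nb p).all fun r => r == q || (s.nb q).contains r) &&
    (s.nb q).all fun r => r == p || (s.nb p).contains r

/-- The sublists of a list that have length at most `n`. -/
def shortSublists : List ℕ → ℕ → List (List ℕ)
  | [], _ => [[]]
  | a :: l, n =>
    match n with
    | 0 => [[]]
    | n + 1 => shortSublists l (n + 1) ++ (shortSublists l n).map (a :: ·)

/-- The vertices of `A` that may be further neighbours of `x`. -/
def candidates (s : PartialGraph) (x : ℕ) (A : ℕ → Bool) : List ℕ :=
  (List.range s.length).filter fun a =>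
    A a && a != x && !s.closed a && !(s.nb x).contains a && Nat.blt (s.nb a).length 4

/-- Among open twins in `C`, the ones of smaller label are chosen first for `T`. -/
def twinClosed (s : PartialGraph) (C T : List ℕ) : Bool :=
  T.all fun q => C.all fun p => !Nat.blt p q || T.contains p || !s.twins p q

/-- The ways, up to exchanging twins, to complete the neighbourhood of `x` to one of order between
`δ` and `4`, by vertices of `A` and at most `m` new vertices. -/
def extensions (δ : ℕ) (s : PartialGraph) (x : ℕ) (A : ℕ → Bool) (m : ℕ) : List PartialGraph :=
  let C := s.candidates x A
  ((shortSublists C (4 - (s.nb x).length)).filter (s.twinClosed C)).flatMap fun T =>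
    ((List.range (m + 1)).filter fun n =>
      Nat.ble δ ((s.nb x).length + T.length + n) && Nat.ble ((s.nb x).length + T.length + n) 4).map
      fun n => (s.addVertices n).join x (T ++ List.range' s.length n)

/-- The case distinctions of the search: `nbrs x` on the neighbourhood of `x`; `isol i j` on a
further vertex (one that is not closed) isolated by deleting `N(i) ∪ N(j)`; `final` recognizes
`C_5^2`. -/
inductive Move
  | nbrs (x : ℕ)
  | isol (i j : ℕ)
  | final

/-- The labels carried by the vertices of `C_5^2` in the one partial graph to which `Move.final`
is applied. -/
def blowUpIndex (p : Fin 5 × Fin 2) : ℕ :=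
  ([[0, 7], [1, 4], [5, 6], [8, 9], [2, 3]].getD p.1 []).getD p.2 0

/-- All vertices `blowUpIndex p` are closed, and they are adjacent as in `C_5^2`. -/
def isBlowUp (s : PartialGraph) : Bool :=
  (List.finRange 5).all fun a => (List.finRange 5).all fun b =>
    (List.finRange 2).all fun c => (List.finRange 2).all fun d =>
      s.closed (blowUpIndex (a, c)) &&
      (s.nb (blowUpIndex (a, c))).contains (blowUpIndex (b, d)) == (a - b == 1 || b - a == 1)

/-- The cases arising from a move, or `none` if the move is not applicable. In `isol i j` the
applicability condition says that the closed vertices do not account for all the isolated vertices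
which criticality demands. -/
def children (δ : ℕ) (s : PartialGraph) : Move → Option (List PartialGraph)
  | .nbrs x =>
    if Nat.blt x s.length then some (s.extensions δ x (fun _ => true) 4) else none
  | .isol i j =>
    let N := s.edgeNbhd i j
    let E := s.enclosed N
    if s.closed i && s.closed j && (s.nb i).contains j &&
      Nat.ble (N.length + (E.filter s.closed).length) 9 then
      some ((E.filter fun x => !s.closed x).flatMap (fun x => s.extensions δ x N.contains 0) ++
        (s.addVertices 1).extensions δ s.length N.contains 0)
    else none
  | .final => if s.isBlowUp then some [] else none

/-- Depth-first search: each move of the script is applied to the topmost case of the stack, and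
the resulting cases that are not refuted replace it. The value is `true` if the script ends with
all cases settled. -/
def run (δ : ℕ) : List Move → List PartialGraph → Bool
  | [], [] => true
  | [], _ :: _ => false
  | _ :: _, [] => false
  | m :: ms, s :: stack =>
    match s.children δ m with
    | none => false
    | some l => run δ ms (l.filter (fun t => !t.refuted δ) ++ stack)

/-- A closed vertex `0` with `δ` neighbours. -/
def star (δ : ℕ) : PartialGraph :=
  (addVertices [(false, [])] δ).join 0 (List.range' 1 δ)

end PartialGraph

/-! ### Graphs without cheap edges -/

namespace SimpleGraph

variable {V : Type*} [Fintype V] [DecidableEq V] (G : SimpleGraph V) [DecidableRel G.Adj]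

/-- `N(u) ∪ N(v)`. For adjacent `u` and `v` this contains both `u` and `v`. -/
def dominated (u v : V) : Finset V := G.neighborFinset u ∪ G.neighborFinset v

/-- The vertices that become isolated when `N(u) ∪ N(v)` is deleted. -/
def stranded (u v : V) : Finset V :=
  {x | x ∉ G.dominated u v ∧ 0 < G.degree x ∧ ∀ y, G.Adj x y → y ∈ G.dominated u v}

/-- `G` has maximum degree at most `4`, every non-isolated vertex has degree at least `δ`, no edge
`uv` is cheap, in the sense that deleting `N(u) ∪ N(v)` costs at most `9` non-isolated vertices,
and `G` contains no induced `C_5^2`. The point of the search is that such a `G` has no edges. -/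
structure IsCritical (δ : ℕ) : Prop where
  pos : 0 < δ
  degree_le : ∀ v, G.degree v ≤ 4
  le_degree : ∀ v, 0 < G.degree v → δ ≤ G.degree v
  ten_le : ∀ u v, G.Adj u v → 10 ≤ (G.dominated u v).card + (G.stranded u v).card
  free : IsEmpty (blownUpFiveCycle ↪g G)

end SimpleGraph

/-! ### Refuting partial graphs -/

namespace PartialGraph

open SimpleGraph

theorem nb_of_length_le {s : PartialGraph} {i : ℕ} (h : s.length ≤ i) : s.nb i = [] := by
  simp [nb, List.getD_eq_getElem?_getD, List.getElem?_eq_none h]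

theorem lt_length_of_mem_nb {s : PartialGraph} {i j : ℕ} (hj : j ∈ s.nb i) : i < s.length := by
  by_contra hi
  rw [nb_of_length_le (by omega)] at hj
  simp at hj

theorem closed_of_length_le {s : PartialGraph} {i : ℕ} (h : s.length ≤ i) :
    s.closed i = false := by
  simp [closed, List.getD_eq_getElem?_getD, List.getElem?_eq_none h]

theorem lt_length_of_closed {s : PartialGraph} {i : ℕ} (hi : s.closed i) : i < s.length := by
  by_contra hlt
  rw [closed_of_length_le (by omega)] at hi
  exact Bool.false_ne_true hi

@[simp]
theorem length_addVertices (s : PartialGraph) (n : ℕ) :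
    (s.addVertices n).length = s.length + n := by
  simp [addVertices]

theorem getD_addVertices (s : PartialGraph) (n i : ℕ) :
    (s.addVertices n).getD i (false, []) = s.getD i (false, []) := by
  simp only [addVertices, List.getD_eq_getElem?_getD]
  by_cases h : i < s.length
  · rw [List.getElem?_append_left h]
  · rw [List.getElem?_append_right (by omega), List.getElem?_eq_none (l := s) (by omega),
      List.getElem?_replicate]
    split_ifs <;> rfl

@[simp]
theorem nb_addVertices (s : PartialGraph) (n i : ℕ) : (s.addVertices n).nb i = s.nb i := by
  rw [nb, nb, getD_addVertices]

@[simp]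
theorem closed_addVertices (s : PartialGraph) (n i : ℕ) :
    (s.addVertices n).closed i = s.closed i := by
  rw [closed, closed, getD_addVertices]

@[simp]
theorem length_join (s : PartialGraph) (x : ℕ) (T : List ℕ) :
    (s.join x T).length = s.length := by
  simp [join]

theorem nb_join {s : PartialGraph} {x : ℕ} {T : List ℕ} (hx : x < s.length)
    (hT : ∀ a ∈ T, a < s.length) (i : ℕ) :
    (s.join x T).nb i = s.nb i ++ if i = x then T else if i ∈ T then [x] else [] := by
  by_cases h : i < s.length
  · simp only [nb, join, List.getD_eq_getElem?_getD]
    rw [List.getElem?_eq_getElem (by simpa using h)]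
    simp [cond_eq_ite]
  · rw [nb_of_length_le (by simpa using h), nb_of_length_le (by simpa using h), if_neg (by omega),
      if_neg fun hi => h (hT i hi)]
    rfl

theorem closed_join {s : PartialGraph} {x : ℕ} (T : List ℕ) (hx : x < s.length) (i : ℕ) :
    (s.join x T).closed i = (s.closed i || i == x) := by
  by_cases h : i < s.length
  · simp only [closed, join, List.getD_eq_getElem?_getD]
    rw [List.getElem?_eq_getElem (by simpa using h)]
    simp
  · rw [closed_of_length_le (by simpa using h), closed_of_length_le (by simpa using h)]
    simp only [Bool.false_or, Bool.false_eq, beq_eq_false_iff_ne]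
    omega

theorem mem_edgeNbhd {s : PartialGraph} {i j a : ℕ} :
    a ∈ s.edgeNbhd i j ↔ a ∈ s.nb i ∨ a ∈ s.nb j := by
  simp only [edgeNbhd, List.mem_append, List.mem_filter, Bool.not_eq_true',
    List.contains_eq_mem, decide_eq_false_iff_not]
  tauto

theorem mem_enclosed {s : PartialGraph} {N : List ℕ} {x : ℕ} :
    x ∈ s.enclosed N ↔ x < s.length ∧ x ∉ N ∧ ∀ a ∈ s.nb x, a ∈ N := by
  simp [enclosed]

variable {V : Type*} [Fintype V]

/-- The partial graph `s` sits in `G` through the labelling `φ`, whose values at numbers beyond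
the length of `s` are irrelevant. -/
structure Realizes (G : SimpleGraph V) [DecidableRel G.Adj] (δ : ℕ) (s : PartialGraph)
    (φ : ℕ → V) : Prop where
  inj : ∀ i < s.length, ∀ j < s.length, φ i = φ j → i = j
  symm : ∀ i j, j ∈ s.nb i → i ∈ s.nb j
  nodup : ∀ i, (s.nb i).Nodup
  adj : ∀ i j, j ∈ s.nb i → G.Adj (φ i) (φ j)
  le_degree : ∀ i < s.length, δ ≤ G.degree (φ i)
  exists_of_adj : ∀ i, s.closed i → ∀ w, G.Adj (φ i) w → ∃ j ∈ s.nb i, φ j = w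

namespace Realizes

variable {G : SimpleGraph V} [DecidableRel G.Adj] {δ : ℕ} {s : PartialGraph} {φ : ℕ → V}

theorem lt_right (h : Realizes G δ s φ) {i j : ℕ} (hj : j ∈ s.nb i) : j < s.length :=
  lt_length_of_mem_nb (h.symm i j hj)

theorem mem_of_closed (h : Realizes G δ s φ) {i j : ℕ} (hi : s.closed i) (hj : j < s.length)
    (ha : G.Adj (φ i) (φ j)) : j ∈ s.nb i := by
  obtain ⟨l, hl, e⟩ := h.exists_of_adj i hi _ ha
  rwa [← h.inj l (h.lt_right hl) j hj e]

theorem nodup_edgeNbhd (h : Realizes G δ s φ) (i j : ℕ) : (s.edgeNbhd i j).Nodup := by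
  rw [edgeNbhd, List.nodup_append]
  refine ⟨h.nodup i, (h.nodup j).filter _, ?_⟩
  rintro a ha b hb rfl
  simp [ha] at hb

theorem lt_of_mem_edgeNbhd (h : Realizes G δ s φ) {i j a : ℕ} (ha : a ∈ s.edgeNbhd i j) :
    a < s.length := by
  rcases mem_edgeNbhd.1 ha with ha | ha
  exacts [h.lt_right ha, h.lt_right ha]

variable [DecidableEq V]

theorem length_add_card_le (h : Realizes G δ s φ) (hdeg : ∀ v, G.degree v ≤ 4) (i : ℕ)
    (X : Finset V) (hX : ∀ x ∈ X, G.Adj (φ i) x) (hX' : ∀ x ∈ X, ∀ j ∈ s.nb i, φ j ≠ x) :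
    (s.nb i).length + X.card ≤ 4 := by
  have h1 : ((s.nb i).toFinset.image φ).card = (s.nb i).length := by
    rw [Finset.card_image_of_injOn, List.toFinset_card_of_nodup (h.nodup i)]
    intro a ha b hb
    simp only [Finset.mem_coe, List.mem_toFinset] at ha hb
    exact h.inj a (h.lt_right ha) b (h.lt_right hb)
  have h2 : Disjoint ((s.nb i).toFinset.image φ) X := by
    rw [Finset.disjoint_left]
    intro w hw hwX
    simp only [Finset.mem_image, List.mem_toFinset] at hw
    obtain ⟨j, hj, rfl⟩ := hw
    exact hX' _ hwX j hj rfl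
  rw [← h1, ← Finset.card_union_of_disjoint h2]
  refine le_trans (Finset.card_le_card ?_) (hdeg (φ i))
  intro w hw
  simp only [Finset.mem_union, Finset.mem_image, List.mem_toFinset] at hw
  rw [mem_neighborFinset]
  rcases hw with ⟨j, hj, rfl⟩ | hw
  · exact h.adj i j hj
  · exact hX w hw

theorem dominated_eq (h : Realizes G δ s φ) {i j : ℕ} (hi : s.closed i) (hj : s.closed j) :
    G.dominated (φ i) (φ j) = (s.edgeNbhd i j).toFinset.image φ := by
  ext w
  simp only [dominated, Finset.mem_union, mem_neighborFinset, Finset.mem_image, List.mem_toFinset,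
    mem_edgeNbhd]
  constructor
  · rintro (hw | hw)
    · obtain ⟨a, ha, e⟩ := h.exists_of_adj i hi w hw
      exact ⟨a, Or.inl ha, e⟩
    · obtain ⟨a, ha, e⟩ := h.exists_of_adj j hj w hw
      exact ⟨a, Or.inr ha, e⟩
  · rintro ⟨a, ha | ha, rfl⟩
    exacts [Or.inl (h.adj i a ha), Or.inr (h.adj j a ha)]

theorem card_dominated (h : Realizes G δ s φ) {i j : ℕ} (hi : s.closed i) (hj : s.closed j) :
    (G.dominated (φ i) (φ j)).card = (s.edgeNbhd i j).length := by
  rw [h.dominated_eq hi hj, Finset.card_image_of_injOn,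
    List.toFinset_card_of_nodup (h.nodup_edgeNbhd i j)]
  intro a ha b hb
  simp only [Finset.mem_coe, List.mem_toFinset] at ha hb
  exact h.inj a (h.lt_of_mem_edgeNbhd ha) b (h.lt_of_mem_edgeNbhd hb)

theorem mem_dominated_iff (h : Realizes G δ s φ) {i j a : ℕ} (hi : s.closed i)
    (hj : s.closed j) (ha : a < s.length) :
    φ a ∈ G.dominated (φ i) (φ j) ↔ a ∈ s.edgeNbhd i j := by
  rw [h.dominated_eq hi hj, Finset.mem_image]
  constructor
  · rintro ⟨b, hb, e⟩
    rw [List.mem_toFinset] at hb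
    rwa [← h.inj b (h.lt_of_mem_edgeNbhd hb) a ha e]
  · exact fun ha => ⟨a, List.mem_toFinset.2 ha, rfl⟩

theorem mem_enclosed_of_mem_stranded (h : Realizes G δ s φ) {i j a : ℕ} (hi : s.closed i)
    (hj : s.closed j) (ha : a < s.length) (hs : φ a ∈ G.stranded (φ i) (φ j)) :
    a ∈ s.enclosed (s.edgeNbhd i j) := by
  simp only [stranded, Finset.mem_filter, Finset.mem_univ, true_and] at hs
  rw [h.mem_dominated_iff hi hj ha] at hs
  refine mem_enclosed.2 ⟨ha, hs.1, fun b hb => ?_⟩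
  exact (h.mem_dominated_iff hi hj (h.lt_right hb)).1 (hs.2.2 _ (h.adj a b hb))

/-- Double counting of the edges between unknown stranded vertices and `N(φ i) ∪ N(φ j)`: each
such vertex has at least `δ` of them, and each uses up a slot. -/
theorem card_stranded_mul_le (h : Realizes G δ s φ) (hG : G.IsCritical δ) {i j : ℕ}
    (hi : s.closed i) (hj : s.closed j) :
    ((G.stranded (φ i) (φ j)).filter fun x => ∀ a < s.length, φ a ≠ x).card * δ ≤
      s.slots (s.edgeNbhd i j) := by
  set J := (G.stranded (φ i) (φ j)).filter fun x => ∀ a < s.length, φ a ≠ x with hJ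
  set N := s.edgeNbhd i j with hN
  have key : ∀ a ∈ N, (J.filter fun x => G.Adj x (φ a)).card ≤
      if s.closed a then 0 else 4 - (s.nb a).length := by
    intro a ha
    split_ifs with hc
    · rw [Nat.le_zero, Finset.card_eq_zero, Finset.filter_eq_empty_iff]
      intro x hx hxa
      obtain ⟨b, hb, e⟩ := h.exists_of_adj a hc x hxa.symm
      exact (Finset.mem_filter.1 hx).2 b (h.lt_right hb) e
    · have := h.length_add_card_le hG.degree_le a (J.filter fun x => G.Adj x (φ a))
        (fun x hx => (Finset.mem_filter.1 hx).2.symm)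
        (fun x hx b hb => (Finset.mem_filter.1 (Finset.mem_filter.1 hx).1).2 b (h.lt_right hb))
      omega
  have h1 : J.card * δ ≤ ∑ x ∈ J, (N.toFinset.filter fun a => G.Adj x (φ a)).card := by
    rw [← smul_eq_mul]
    refine Finset.card_nsmul_le_sum _ _ _ fun x hx => ?_
    have hx' := (Finset.mem_filter.1 hx).1
    simp only [stranded, Finset.mem_filter, Finset.mem_univ, true_and] at hx'
    refine (hG.le_degree x hx'.2.1).trans ?_
    rw [← card_neighborFinset_eq_degree]
    refine le_trans (Finset.card_le_card ?_)
      (Finset.card_image_le (s := N.toFinset.filter fun a => G.Adj x (φ a)) (f := φ))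
    intro y hy
    rw [mem_neighborFinset] at hy
    have := hx'.2.2 y hy
    rw [h.dominated_eq hi hj, Finset.mem_image] at this
    obtain ⟨a, ha, rfl⟩ := this
    exact Finset.mem_image.2 ⟨a, Finset.mem_filter.2 ⟨ha, hy⟩, rfl⟩
  refine h1.trans ?_
  refine (Finset.sum_card_bipartiteAbove_eq_sum_card_bipartiteBelow (s := J) (t := N.toFinset)
    fun x a => G.Adj x (φ a)).le.trans ?_
  refine (Finset.sum_le_sum fun a ha => key a (List.mem_toFinset.1 ha)).trans ?_
  rw [slots, List.sum_toFinset _ (h.nodup_edgeNbhd i j)]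

theorem not_refutes (h : Realizes G δ s φ) (hG : G.IsCritical δ) {i j : ℕ}
    (hi : s.closed i) (hj : s.closed j) (hij : j ∈ s.nb i) : s.refutes δ i j = false := by
  have h10 := hG.ten_le _ _ (h.adj i j hij)
  have h1 := h.card_stranded_mul_le hG hi hj
  rw [← Nat.le_div_iff_mul_le hG.pos] at h1
  have h2 : ((G.stranded (φ i) (φ j)).filter fun x => ¬ ∀ a < s.length, φ a ≠ x).card ≤
      (s.enclosed (s.edgeNbhd i j)).length := by
    refine le_trans (Finset.card_le_card (t := (s.enclosed (s.edgeNbhd i j)).toFinset.image φ) ?_)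
      (Finset.card_image_le.trans (List.toFinset_card_le _))
    intro x hx
    obtain ⟨hx, hx'⟩ := Finset.mem_filter.1 hx
    push Not at hx'
    obtain ⟨a, ha, rfl⟩ := hx'
    exact Finset.mem_image.2
      ⟨a, List.mem_toFinset.2 (h.mem_enclosed_of_mem_stranded hi hj ha hx), rfl⟩
  have h3 := Finset.card_filter_add_card_filter_not (s := G.stranded (φ i) (φ j))
    (fun x => ∀ a < s.length, φ a ≠ x)
  rw [h.card_dominated hi hj] at h10
  rw [refutes, Bool.eq_false_iff, Ne, Nat.ble_eq]
  omega

theorem not_refuted (h : Realizes G δ s φ) (hG : G.IsCritical δ) : s.refuted δ = false := by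
  by_contra hr
  simp only [refuted, Bool.not_eq_false, List.any_eq_true, Bool.and_eq_true] at hr
  obtain ⟨i, -, hi, j, hij, ⟨-, hj⟩, hr⟩ := hr
  rw [h.not_refutes hG hi hj hij] at hr
  exact Bool.false_ne_true hr

end Realizes

end PartialGraph

/-! ### Extending partial graphs -/

namespace PartialGraph

open SimpleGraph

theorem mem_shortSublists {T l : List ℕ} (h : T.Sublist l) :
    ∀ {n : ℕ}, T.length ≤ n → T ∈ shortSublists l n := by
  induction h with
  | slnil => intro n _; simp [shortSublists]
  | @cons T l a h ih =>
    intro n hn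
    cases n with
    | zero => simpa [shortSublists] using hn
    | succ n => exact List.mem_append_left _ (ih hn)
  | @cons_cons T l a h ih =>
    intro n hn
    cases n with
    | zero => simp at hn
    | succ n =>
      exact List.mem_append_right _ (List.mem_map_of_mem (ih (by simpa using hn)))

theorem mem_candidates {s : PartialGraph} {x a : ℕ} {A : ℕ → Bool} :
    a ∈ s.candidates x A ↔ a < s.length ∧ A a ∧ a ≠ x ∧ s.closed a = false ∧ a ∉ s.nb x ∧
      (s.nb a).length < 4 := by
  simp [candidates, and_assoc]

theorem twins_iff {s : PartialGraph} {p q : ℕ} :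
    s.twins p q ↔ (∀ r ∈ s.nb p, r = q ∨ r ∈ s.nb q) ∧ ∀ r ∈ s.nb q, r = p ∨ r ∈ s.nb p := by
  simp [twins]

theorem twinClosed_iff {s : PartialGraph} {C T : List ℕ} :
    s.twinClosed C T ↔ ∀ q ∈ T, ∀ p ∈ C, p < q → s.twins p q → p ∈ T := by
  simp only [twinClosed, List.all_eq_true, Bool.or_eq_true, Bool.not_eq_true',
    List.contains_eq_mem, decide_eq_true_eq]
  refine forall₄_congr fun q _ p _ => ?_
  rw [← Bool.not_eq_true, ← Bool.not_eq_true, Nat.blt_eq]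
  tauto

namespace Realizes

variable {V : Type*} [Fintype V] {G : SimpleGraph V} [DecidableRel G.Adj] {δ : ℕ}
  {s : PartialGraph} {φ : ℕ → V}

theorem congr {ψ : ℕ → V} (h : Realizes G δ s φ) (hψ : ∀ i < s.length, ψ i = φ i) :
    Realizes G δ s ψ where
  inj i hi j hj e := h.inj i hi j hj (by rwa [← hψ i hi, ← hψ j hj])
  symm := h.symm
  nodup := h.nodup
  adj i j hj := by
    rw [hψ i (lt_length_of_mem_nb hj), hψ j (h.lt_right hj)]
    exact h.adj i j hj
  le_degree i hi := by rw [hψ i hi]; exact h.le_degree i hi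
  exists_of_adj i hi w hw := by
    rw [hψ i (lt_length_of_closed hi)] at hw
    obtain ⟨j, hj, e⟩ := h.exists_of_adj i hi w hw
    exact ⟨j, hj, by rw [hψ j (h.lt_right hj), e]⟩

theorem exists_addVertices (h : Realizes G δ s φ) (W : List V) (hW : W.Nodup)
    (hnew : ∀ w ∈ W, ∀ i < s.length, φ i ≠ w) (hdeg : ∀ w ∈ W, δ ≤ G.degree w) :
    ∃ ψ : ℕ → V, Realizes G δ (s.addVertices W.length) ψ ∧ (∀ i < s.length, ψ i = φ i) ∧
      (∀ i, s.length ≤ i → i < s.length + W.length → ψ i ∈ W) ∧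
      ∀ w ∈ W, ∃ i, s.length ≤ i ∧ i < s.length + W.length ∧ ψ i = w := by
  set ψ : ℕ → V := fun i => if i < s.length then φ i else W.getD (i - s.length) (φ i) with hψ
  have hold : ∀ i < s.length, ψ i = φ i := fun i hi => if_pos hi
  have hψW : ∀ i, ¬ i < s.length → ∀ hi : i - s.length < W.length, ψ i = W[i - s.length] := by
    intro i hi hi'
    simp only [hψ, if_neg hi]
    exact List.getD_eq_getElem _ _ hi'
  have h' := h.congr hold
  refine ⟨ψ, ⟨?_, ?_, ?_, ?_, ?_, ?_⟩, hold, ?_, ?_⟩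
  · intro i hi j hj e
    rw [length_addVertices] at hi hj
    by_cases hi' : i < s.length <;> by_cases hj' : j < s.length
    · exact h'.inj i hi' j hj' e
    · rw [hold i hi', hψW j hj' (by omega)] at e
      exact absurd e (hnew _ (List.getElem_mem _) i hi')
    · rw [hold j hj', hψW i hi' (by omega)] at e
      exact absurd e.symm (hnew _ (List.getElem_mem _) j hj')
    · rw [hψW i hi' (by omega), hψW j hj' (by omega), hW.getElem_inj_iff] at e
      omega
  · simpa using h'.symm
  · simpa using h'.nodup
  · simpa using h'.adj
  · intro i hi
    rw [length_addVertices] at hi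
    by_cases hi' : i < s.length
    · exact h'.le_degree i hi'
    · rw [hψW i hi' (by omega)]
      exact hdeg _ (List.getElem_mem _)
  · simpa using h'.exists_of_adj
  · intro i hi hi'
    rw [hψW i (by omega) (by omega)]
    exact List.getElem_mem _
  · intro w hw
    obtain ⟨n, hn, rfl⟩ := List.getElem_of_mem hw
    refine ⟨s.length + n, by omega, by omega, ?_⟩
    rw [hψW _ (by omega) (by omega)]
    simp

theorem join (h : Realizes G δ s φ) {x : ℕ} {T : List ℕ} (hx : x < s.length)
    (hT : T.Nodup) (hTlt : ∀ a ∈ T, a < s.length) (hTx : ∀ a ∈ T, a ∉ s.nb x)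
    (hTadj : ∀ a ∈ T, G.Adj (φ x) (φ a))
    (hall : ∀ w, G.Adj (φ x) w → ∃ j ∈ s.nb x ++ T, φ j = w) :
    Realizes G δ (s.join x T) φ := by
  have hxT : x ∉ T := fun hxT => (hTadj x hxT).ne rfl
  have hmem : ∀ i j, j ∈ (s.join x T).nb i ↔
      j ∈ s.nb i ∨ (i = x ∧ j ∈ T) ∨ (i ∈ T ∧ j = x) := by
    intro i j
    rw [nb_join hx hTlt, List.mem_append]
    split_ifs with h1 h2
    · subst h1; tauto
    · simp only [List.mem_singleton]; tauto
    · simp only [List.not_mem_nil]; tauto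
  refine ⟨?_, ?_, ?_, ?_, ?_, ?_⟩
  · simpa using h.inj
  · intro i j hj
    rw [hmem] at hj ⊢
    rcases hj with hj | hj | hj
    · exact Or.inl (h.symm i j hj)
    · exact Or.inr (Or.inr hj.symm)
    · exact Or.inr (Or.inl hj.symm)
  · intro i
    rw [nb_join hx hTlt]
    split_ifs with h1 h2
    · subst h1
      refine List.nodup_append.2 ⟨h.nodup i, hT, ?_⟩
      rintro a ha b hb rfl
      exact hTx a hb ha
    · refine List.nodup_append.2 ⟨h.nodup i, List.nodup_singleton x, ?_⟩
      rintro a ha b hb rfl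
      rw [List.mem_singleton] at hb
      subst hb
      exact hTx i h2 (h.symm _ _ ha)
    · simpa using h.nodup i
  · intro i j hj
    rw [hmem] at hj
    rcases hj with hj | ⟨rfl, hj⟩ | ⟨hi, rfl⟩
    · exact h.adj i j hj
    · exact hTadj j hj
    · exact (hTadj i hi).symm
  · simpa using h.le_degree
  · intro i hi w hw
    rw [closed_join T hx] at hi
    by_cases hix : i = x
    · subst hix
      obtain ⟨j, hj, e⟩ := hall w hw
      refine ⟨j, (hmem i j).2 ?_, e⟩
      rcases List.mem_append.1 hj with hj | hj
      · exact Or.inl hj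
      · exact Or.inr (Or.inl ⟨rfl, hj⟩)
    · simp only [hix, Bool.or_eq_true, beq_iff_eq, or_false] at hi
      obtain ⟨j, hj, e⟩ := h.exists_of_adj i hi w hw
      exact ⟨j, (hmem i j).2 (Or.inl hj), e⟩

theorem notMem_self (h : Realizes G δ s φ) (i : ℕ) : i ∉ s.nb i :=
  fun hi => (h.adj i i hi).ne rfl

/-- Exchanging two open twins gives another realization. -/
theorem swap (h : Realizes G δ s φ) {p q : ℕ} (hp : p < s.length) (hq : q < s.length)
    (hpc : s.closed p = false) (hqc : s.closed q = false) (ht : s.twins p q) :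
    Realizes G δ s (φ ∘ Equiv.swap p q) := by
  obtain ⟨h1, h2⟩ := twins_iff.1 ht
  have hlt : ∀ i, i < s.length → Equiv.swap p q i < s.length := by
    intro i hi
    rw [Equiv.swap_apply_def]
    split_ifs <;> assumption
  have hnb : ∀ i j, j ∈ s.nb i → Equiv.swap p q j ∈ s.nb (Equiv.swap p q i) := by
    intro i j hj
    have hs := h.symm
    have hi := h.notMem_self
    rw [Equiv.swap_apply_def, Equiv.swap_apply_def]
    split_ifs <;> grind
  refine ⟨?_, h.symm, h.nodup, fun i j hj => h.adj _ _ (hnb i j hj),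
    fun i hi => h.le_degree _ (hlt i hi), ?_⟩
  · intro i hi j hj e
    exact (Equiv.swap p q).injective (h.inj _ (hlt i hi) _ (hlt j hj) e)
  · intro i hi w hw
    have e : Equiv.swap p q i = i := by
      refine Equiv.swap_apply_of_ne_of_ne ?_ ?_ <;> rintro rfl <;> simp_all
    rw [Function.comp_apply, e] at hw
    obtain ⟨j, hj, rfl⟩ := h.exists_of_adj i hi w hw
    exact ⟨Equiv.swap p q j, by simpa only [e] using hnb i j hj, by simp⟩

/-- The labelling can be chosen such that the neighbours of the vertex `x` take the twins of
smaller label first: otherwise exchanging two twins lowers the sum of the labels of the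
neighbours. -/
theorem exists_twinClosed (h : Realizes G δ s φ) {x : ℕ} {A : ℕ → Bool}
    (hA : ∀ a < s.length, G.Adj (φ x) (φ a) → a ∈ s.nb x ∨ A a) :
    ∃ ψ : ℕ → V, Realizes G δ s ψ ∧ ψ x = φ x ∧
      (∀ w, (∃ a < s.length, φ a = w) → ∃ a < s.length, ψ a = w) ∧
      (∀ a < s.length, G.Adj (ψ x) (ψ a) → a ∈ s.nb x ∨ A a) ∧
      s.twinClosed (s.candidates x A)
        ((s.candidates x A).filter fun a => G.Adj (ψ x) (ψ a)) := by
  set C := s.candidates x A with hC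
  have hCn : C.Nodup := List.nodup_range.filter _
  induction hm : ∑ a ∈ C.toFinset.filter (fun a => G.Adj (φ x) (φ a)), a using
    Nat.strong_induction_on generalizing φ with
  | _ m ih =>
  by_cases htc : s.twinClosed C (C.filter fun a => G.Adj (φ x) (φ a))
  · exact ⟨φ, h, rfl, fun w hw => hw, hA, htc⟩
  rw [twinClosed_iff] at htc
  push Not at htc
  obtain ⟨q, hq, p, hp, hpq, ht, hpT⟩ := htc
  obtain ⟨hqC, hqadj⟩ := List.mem_filter.1 hq
  have hpadj : ¬ G.Adj (φ x) (φ p) := fun hadj => hpT (List.mem_filter.2 ⟨hp, by simpa using hadj⟩)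
  replace hqadj : G.Adj (φ x) (φ q) := by simpa using hqadj
  obtain ⟨hpl, hpA, hpx, hpc, -, -⟩ := mem_candidates.1 hp
  obtain ⟨hql, hqA, hqx, hqc, -, -⟩ := mem_candidates.1 hqC
  have hx : Equiv.swap p q x = x := Equiv.swap_apply_of_ne_of_ne hpx.symm hqx.symm
  have hswap := h.swap hpl hql hpc hqc ht
  have hlt : ∀ i, i < s.length → Equiv.swap p q i < s.length := by
    intro i hi
    rw [Equiv.swap_apply_def]
    split_ifs <;> assumption
  have hA' : ∀ a < s.length, G.Adj ((φ ∘ Equiv.swap p q) x) ((φ ∘ Equiv.swap p q) a) →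
      a ∈ s.nb x ∨ A a := by
    intro a ha hadj
    rw [Function.comp_apply, Function.comp_apply, hx] at hadj
    by_cases hap : a = p
    · exact Or.inr (hap ▸ hpA)
    by_cases haq : a = q
    · exact Or.inr (haq ▸ hqA)
    rw [Equiv.swap_apply_of_ne_of_ne hap haq] at hadj
    exact hA a ha hadj
  have hlt' : ∑ a ∈ C.toFinset.filter (fun a => G.Adj ((φ ∘ Equiv.swap p q) x)
      ((φ ∘ Equiv.swap p q) a)), a < m := by
    rw [← hm]
    simp only [Function.comp_apply, hx]
    have e : C.toFinset.filter (fun a => G.Adj (φ x) (φ (Equiv.swap p q a))) =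
        insert p ((C.toFinset.filter fun a => G.Adj (φ x) (φ a)).erase q) := by
      ext a
      simp only [Finset.mem_filter, List.mem_toFinset, Finset.mem_insert, Finset.mem_erase]
      rw [Equiv.swap_apply_def]
      split_ifs with ha ha'
      · subst ha; simp [hp, hqadj]
      · subst ha'; simp [hpadj, ha]
      · tauto
    have hqm : q ∈ C.toFinset.filter fun a => G.Adj (φ x) (φ a) := by simp [hqC, hqadj]
    rw [e, Finset.sum_insert (by simp [hpadj]), ← Finset.add_sum_erase _ _ hqm]
    omega
  obtain ⟨ψ, h1, h2, h3, h4, h5⟩ := ih _ hlt' hswap hA' rfl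
  refine ⟨ψ, h1, by rw [h2, Function.comp_apply, hx], ?_, h4, h5⟩
  rintro w ⟨a, ha, rfl⟩
  exact h3 _ ⟨Equiv.swap p q a, hlt a ha, by simp⟩

/-- Case distinction on the neighbourhood of `x` is exhaustive up to relabelling. -/
theorem exists_extension [DecidableEq V] (h : Realizes G δ s φ) (hG : G.IsCritical δ) {x : ℕ}
    {A : ℕ → Bool} {m : ℕ} (hx : x < s.length)
    (hA : ∀ a < s.length, G.Adj (φ x) (φ a) → a ∈ s.nb x ∨ A a)
    (hm : m = 4 ∨ ∀ w, G.Adj (φ x) w → ∃ a < s.length, φ a = w) :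
    ∃ t ∈ s.extensions δ x A m, ∃ ψ : ℕ → V, Realizes G δ t ψ := by
  obtain ⟨ψ, h', hψx, himg, hA', htc⟩ := h.exists_twinClosed hA
  replace hm : m = 4 ∨ ∀ w, G.Adj (ψ x) w → ∃ a < s.length, ψ a = w := by
    rw [hψx]
    exact hm.imp_right fun hm w hw => himg w (hm w hw)
  clear himg hψx hA h
  set C := s.candidates x A with hC
  set T := C.filter fun a => G.Adj (ψ x) (ψ a) with hT
  have hTC : T.Sublist C := List.filter_sublist
  have hTn : T.Nodup := hTC.nodup (List.nodup_range.filter _)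
  have hTmem : ∀ a ∈ T, a < s.length ∧ a ∉ s.nb x ∧ G.Adj (ψ x) (ψ a) := by
    intro a ha
    obtain ⟨h1, h2⟩ := List.mem_filter.1 ha
    have := mem_candidates.1 h1
    exact ⟨this.1, this.2.2.2.2.1, by simpa using h2⟩
  have hold : ∀ a < s.length, G.Adj (ψ x) (ψ a) → a ∈ s.nb x ++ T := by
    intro a ha hadj
    rw [List.mem_append]
    by_cases hax : a ∈ s.nb x
    · exact Or.inl hax
    have hxa : x ∉ s.nb a := fun hxa => hax (h'.symm _ _ hxa)
    refine Or.inr (List.mem_filter.2 ⟨mem_candidates.2 ⟨ha, (hA' a ha hadj).resolve_left hax, ?_,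
      ?_, hax, ?_⟩, by simpa using hadj⟩)
    · rintro rfl
      exact hadj.ne rfl
    · rw [← Bool.not_eq_true]
      exact fun hac => hxa (h'.mem_of_closed hac hx hadj.symm)
    · have := h'.length_add_card_le hG.degree_le a {ψ x}
        (by simpa using hadj.symm)
        (by
          simp only [Finset.mem_singleton, forall_eq]
          intro j hj e
          exact hxa (h'.inj j (h'.lt_right hj) x hx e ▸ hj))
      simpa using this
  -- `T` are the neighbours of `x` among the open vertices, `W` those that are not yet labelled.
  set W := ((G.neighborFinset (ψ x)).filter fun w => ∀ a < s.length, ψ a ≠ w).toList with hW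
  have hWmem : ∀ w, w ∈ W ↔ G.Adj (ψ x) w ∧ ∀ a < s.length, ψ a ≠ w := by
    intro w
    rw [hW, Finset.mem_toList, Finset.mem_filter, mem_neighborFinset]
  have hdeg : G.degree (ψ x) = (s.nb x).length + T.length + W.length := by
    have hn : (s.nb x ++ T).Nodup := by
      refine List.nodup_append.2 ⟨h'.nodup x, hTn, ?_⟩
      rintro a ha b hb rfl
      exact (hTmem a hb).2.1 ha
    have hlt : ∀ a ∈ s.nb x ++ T, a < s.length := by
      intro a ha
      rcases List.mem_append.1 ha with ha | ha
      exacts [h'.lt_right ha, (hTmem a ha).1]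
    have h1 : ((G.neighborFinset (ψ x)).filter fun w => ¬ ∀ a < s.length, ψ a ≠ w) =
        (s.nb x ++ T).toFinset.image ψ := by
      ext w
      simp only [Finset.mem_filter, mem_neighborFinset, Finset.mem_image, List.mem_toFinset]
      constructor
      · rintro ⟨hw, hw'⟩
        push Not at hw'
        obtain ⟨a, ha, rfl⟩ := hw'
        exact ⟨a, hold a ha hw, rfl⟩
      · rintro ⟨a, ha, rfl⟩
        refine ⟨?_, fun hno => hno a (hlt a ha) rfl⟩
        rcases List.mem_append.1 ha with ha | ha
        exacts [h'.adj x a ha, (hTmem a ha).2.2]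
    have h2 : ((s.nb x ++ T).toFinset.image ψ).card = (s.nb x).length + T.length := by
      rw [Finset.card_image_of_injOn, List.toFinset_card_of_nodup hn, List.length_append]
      intro a ha b hb
      simp only [Finset.mem_coe, List.mem_toFinset] at ha hb
      exact h'.inj a (hlt a ha) b (hlt b hb)
    rw [← card_neighborFinset_eq_degree, ← Finset.card_filter_add_card_filter_not
      (s := G.neighborFinset (ψ x)) (fun w => ∀ a < s.length, ψ a ≠ w), h1, h2, hW,
      Finset.length_toList, add_comm]
  have hle := hG.degree_le (ψ x)
  have hge := h'.le_degree x hx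
  obtain ⟨χ, hχ, hχold, hχnew, hχW⟩ := h'.exists_addVertices W (Finset.nodup_toList _)
    (fun w hw => ((hWmem w).1 hw).2)
    (fun w hw => hG.le_degree w ((G.degree_pos_iff_exists_adj w).2 ⟨ψ x, ((hWmem w).1 hw).1.symm⟩))
  have hWm : W.length ≤ m := by
    rcases hm with rfl | hm
    · omega
    · have : W = [] := by
        refine List.eq_nil_iff_forall_not_mem.2 fun w hw => ?_
        obtain ⟨hadj, hne⟩ := (hWmem w).1 hw
        obtain ⟨a, ha, e⟩ := hm w hadj
        exact hne a ha e
      simp [this]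
  refine ⟨(s.addVertices W.length).join x (T ++ List.range' s.length W.length), ?_, χ, ?_⟩
  · refine List.mem_flatMap.2 ⟨T, List.mem_filter.2 ⟨mem_shortSublists hTC (by omega), htc⟩, ?_⟩
    refine List.mem_map.2 ⟨W.length, List.mem_filter.2 ⟨List.mem_range.2 (by omega), ?_⟩, rfl⟩
    rw [Bool.and_eq_true, Nat.ble_eq, Nat.ble_eq]
    omega
  · have hr : ∀ a, a ∈ List.range' s.length W.length ↔
        s.length ≤ a ∧ a < s.length + W.length := fun a => List.mem_range'_1
    refine hχ.join ?_ ?_ ?_ ?_ ?_ ?_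
    · rw [length_addVertices]; omega
    · refine List.nodup_append.2 ⟨hTn, List.nodup_range', ?_⟩
      rintro a ha b hb rfl
      have := (hTmem a ha).1
      have := ((hr a).1 hb).1
      omega
    · intro a ha
      rw [length_addVertices]
      rcases List.mem_append.1 ha with ha | ha
      · have := (hTmem a ha).1
        omega
      · exact ((hr a).1 ha).2
    · intro a ha
      rw [nb_addVertices]
      rcases List.mem_append.1 ha with ha | ha
      · exact (hTmem a ha).2.1
      · intro hmem
        have := h'.lt_right hmem
        have := ((hr a).1 ha).1
        omega
    · intro a ha
      rw [hχold x hx]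
      rcases List.mem_append.1 ha with ha | ha
      · rw [hχold a (hTmem a ha).1]
        exact (hTmem a ha).2.2
      · obtain ⟨h1, h2⟩ := (hr a).1 ha
        exact ((hWmem _).1 (hχnew a h1 h2)).1
    · intro w hw
      rw [hχold x hx] at hw
      by_cases hwW : w ∈ W
      · obtain ⟨i, h1, h2, e⟩ := hχW w hwW
        exact ⟨i, by simp [hr, h1, h2], e⟩
      · have : ∃ a < s.length, ψ a = w := by
          by_contra hno
          push Not at hno
          exact hwW ((hWmem w).2 ⟨hw, hno⟩)
        obtain ⟨a, ha, rfl⟩ := this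
        refine ⟨a, ?_, hχold a ha⟩
        have := List.mem_append.1 (hold a ha hw)
        simp only [nb_addVertices, List.mem_append]
        tauto

end Realizes

end PartialGraph

/-! ### Soundness of the search -/

namespace PartialGraph

open SimpleGraph

variable {V : Type*} [Fintype V] [DecidableEq V] {G : SimpleGraph V} [DecidableRel G.Adj] {δ : ℕ}
  {s : PartialGraph} {φ : ℕ → V}

theorem blowUpIndex_injective : Function.Injective blowUpIndex := by
  decide +kernel

namespace Realizes

/-- A partial graph recognized as `C_5^2` would be an induced subgraph, as its vertices are
closed. -/
theorem not_isBlowUp (h : Realizes G δ s φ) (hG : G.IsCritical δ) : s.isBlowUp = false := by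
  by_contra hb
  simp only [isBlowUp, Bool.not_eq_false, List.all_eq_true, List.mem_finRange, true_implies,
    Bool.and_eq_true, beq_iff_eq] at hb
  have hc : ∀ p, s.closed (blowUpIndex p) := fun p => (hb p.1 0 p.2 0).1
  refine hG.free.false ⟨⟨fun p => φ (blowUpIndex p), fun p q e => blowUpIndex_injective
    (h.inj _ (lt_length_of_closed (hc p)) _ (lt_length_of_closed (hc q)) e)⟩, ?_⟩
  intro p q
  have h1 := (hb p.1 q.1 p.2 q.2).2
  have h2 : G.Adj (φ (blowUpIndex p)) (φ (blowUpIndex q)) ↔ blowUpIndex q ∈ s.nb (blowUpIndex p) :=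
    ⟨h.mem_of_closed (hc p) (lt_length_of_closed (hc q)), h.adj _ _⟩
  change G.Adj (φ (blowUpIndex p)) (φ (blowUpIndex q)) ↔ (cycleGraph 5).Adj p.1 q.1
  rw [h2, cycleGraph_adj, ← List.contains_iff_mem, h1]
  simp

/-- Moves are exhaustive: some case of an applicable move is realized again. -/
theorem exists_child (h : Realizes G δ s φ) (hG : G.IsCritical δ) {m : Move}
    {l : List PartialGraph} (hl : s.children δ m = some l) :
    ∃ t ∈ l, ∃ ψ : ℕ → V, Realizes G δ t ψ := by
  cases m with
  | nbrs x =>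
    simp only [children, Nat.blt_eq, Option.ite_none_right_eq_some, Option.some.injEq] at hl
    obtain ⟨hx, rfl⟩ := hl
    exact h.exists_extension hG hx (fun _ _ _ => Or.inr rfl) (Or.inl rfl)
  | final =>
    simp [children, h.not_isBlowUp hG] at hl
  | isol i j =>
    simp only [children, Bool.and_eq_true, Option.ite_none_right_eq_some, Option.some.injEq,
      Nat.ble_eq, List.contains_eq_mem, decide_eq_true_eq] at hl
    obtain ⟨⟨⟨⟨hi, hj⟩, hij⟩, hle⟩, rfl⟩ := hl
    set N := s.edgeNbhd i j with hN
    have h10 := hG.ten_le _ _ (h.adj i j hij)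
    rw [h.card_dominated hi hj, ← hN] at h10
    -- The closed enclosed vertices are too few to make up the ten vertices required, so some
    -- stranded vertex `y` is open or not yet labelled.
    obtain ⟨y, hy, hyc⟩ : ∃ y ∈ G.stranded (φ i) (φ j),
        y ∉ ((s.enclosed N).filter s.closed).toFinset.image φ := by
      by_contra hno
      push Not at hno
      have := (Finset.card_le_card hno).trans
        (Finset.card_image_le.trans (List.toFinset_card_le _))
      omega
    have hy' := hy
    simp only [stranded, Finset.mem_filter, Finset.mem_univ, true_and] at hy'
    by_cases hold : ∃ x < s.length, φ x = y
    · obtain ⟨x, hx, rfl⟩ := hold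
      have hxE := h.mem_enclosed_of_mem_stranded hi hj hx hy
      obtain ⟨t, ht, ψ, hψ⟩ := h.exists_extension hG (A := fun a => N.contains a) (m := 0) hx
        (fun a ha hadj => Or.inr <| by
          simpa using (h.mem_dominated_iff hi hj ha).1 (hy'.2.2 _ hadj))
        (Or.inr fun w hw => by
          have := hy'.2.2 w hw
          rw [h.dominated_eq hi hj, Finset.mem_image] at this
          obtain ⟨a, ha, e⟩ := this
          exact ⟨a, h.lt_of_mem_edgeNbhd (List.mem_toFinset.1 ha), e⟩)
      refine ⟨t, List.mem_append_left _ (List.mem_flatMap.2 ⟨x, List.mem_filter.2 ⟨hxE, ?_⟩, ht⟩),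
        ψ, hψ⟩
      rw [Bool.not_eq_true', ← Bool.not_eq_true]
      intro hxc
      exact hyc (Finset.mem_image.2
        ⟨x, List.mem_toFinset.2 (List.mem_filter.2 ⟨hxE, hxc⟩), rfl⟩)
    · push Not at hold
      obtain ⟨χ, hχ, hχold, -, hχy⟩ := h.exists_addVertices [y] (List.nodup_singleton y)
        (by simpa using hold) (by simpa using hG.le_degree y hy'.2.1)
      obtain ⟨x, hx1, hx2, rfl⟩ := hχy y (List.mem_singleton_self y)
      obtain rfl : x = s.length := by
        rw [List.length_singleton] at hx2; omega
      have hdom : ∀ w, G.Adj (χ s.length) w → ∃ a ∈ N, χ a = w := by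
        intro w hw
        have := hy'.2.2 w hw
        rw [h.dominated_eq hi hj, Finset.mem_image] at this
        obtain ⟨a, ha, e⟩ := this
        rw [List.mem_toFinset] at ha
        exact ⟨a, ha, by rw [hχold a (h.lt_of_mem_edgeNbhd ha), e]⟩
      have hlen : ∀ a ∈ N, a < (s.addVertices 1).length := fun a ha => by
        have := h.lt_of_mem_edgeNbhd ha
        rw [length_addVertices]; omega
      obtain ⟨t, ht, ψ, hψ⟩ := hχ.exists_extension hG (x := s.length)
        (A := fun a => N.contains a) (m := 0) (by simp)
        (fun a ha hadj => Or.inr <| by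
          obtain ⟨b, hb, e⟩ := hdom _ hadj
          rw [← hχ.inj b (hlen b hb) a ha e]
          simpa using hb)
        (Or.inr fun w hw => by
          obtain ⟨a, ha, e⟩ := hdom w hw
          exact ⟨a, hlen a ha, e⟩)
      exact ⟨t, List.mem_append_right _ ht, ψ, hψ⟩

/-- Soundness of the search. -/
theorem not_realizes_of_run (hG : G.IsCritical δ) (ms : List Move) :
    ∀ {stack : List PartialGraph}, run δ ms stack → ∀ s ∈ stack, ∀ φ : ℕ → V,
      ¬ Realizes G δ s φ := by
  induction ms with
  | nil =>
    intro stack hrun s hs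
    cases stack with
    | nil => simp at hs
    | cons => simp [run] at hrun
  | cons m ms ih =>
    intro stack hrun s hs φ h
    cases stack with
    | nil => simp at hs
    | cons t stack =>
      simp only [run] at hrun
      split at hrun
      · simp at hrun
      · rename_i l hl
        rcases List.mem_cons.1 hs with rfl | hs
        · obtain ⟨u, hu, ψ, hψ⟩ := h.exists_child hG hl
          refine ih hrun u (List.mem_append_left _ (List.mem_filter.2 ⟨hu, ?_⟩)) ψ hψ
          rw [hψ.not_refuted hG]
          rfl
        · exact ih hrun s (List.mem_append_right _ hs) φ h

theorem exists_star (hG : G.IsCritical δ) {r : V} (hr : G.degree r = δ) :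
    ∃ φ : ℕ → V, Realizes G δ (star δ) φ := by
  have h0 : Realizes G δ [(false, [])] fun _ => r := by
    have hnb : ∀ i, nb [(false, [])] i = [] := by
      rintro (_ | i) <;> rfl
    have hc : ∀ i, closed [(false, [])] i = false := by
      rintro (_ | i) <;> rfl
    refine ⟨?_, ?_, ?_, ?_, ?_, ?_⟩
    · intro i hi j hj _
      rw [List.length_singleton] at hi hj
      omega
    · simp [hnb]
    · simp [hnb]
    · simp [hnb]
    · simp [hr]
    · simp [hc]
  have hlen : (G.neighborFinset r).toList.length = δ := by
    rw [Finset.length_toList, card_neighborFinset_eq_degree, hr]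
  obtain ⟨χ, hχ, hχold, hχnew, hχW⟩ := h0.exists_addVertices (G.neighborFinset r).toList
    (Finset.nodup_toList _)
    (fun w hw i _ => by
      rw [Finset.mem_toList, mem_neighborFinset] at hw
      exact hw.ne)
    (fun w hw => by
      rw [Finset.mem_toList, mem_neighborFinset] at hw
      exact hG.le_degree w ((G.degree_pos_iff_exists_adj w).2 ⟨r, hw.symm⟩))
  rw [hlen] at hχ hχnew hχW
  have hχ0 : χ 0 = r := hχold 0 (by simp)
  simp only [List.length_singleton] at hχnew hχW
  refine ⟨χ, hχ.join (by simp) List.nodup_range' ?_ ?_ ?_ ?_⟩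
  · intro a ha
    rw [length_addVertices, List.length_singleton]
    exact (List.mem_range'_1.1 ha).2
  · intro a _
    rw [nb_addVertices]
    exact List.not_mem_nil
  · intro a ha
    obtain ⟨h1, h2⟩ := List.mem_range'_1.1 ha
    have := hχnew a h1 h2
    rwa [Finset.mem_toList, mem_neighborFinset, ← hχ0] at this
  · intro w hw
    rw [hχ0] at hw
    obtain ⟨i, h1, h2, e⟩ := hχW w (by rwa [Finset.mem_toList, mem_neighborFinset])
    exact ⟨i, List.mem_append_right _ (List.mem_range'_1.2 ⟨h1, h2⟩), e⟩

end Realizes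

end PartialGraph

/-! ### Evaluation of the search -/

namespace PartialGraph

/-- A script that settles the graphs of minimum positive degree one. Any script accepted by `run`
would do; its choice matters only for the size of the search. -/
def scriptDegreeOne : List Move :=
  [.nbrs 1, .isol 0 1, .nbrs 2, .isol 2 4, .isol 0 1, .isol 0 1, .isol 0 1, .nbrs 2, .isol 2 5,
    .isol 2 5, .isol 0 1, .nbrs 4, .nbrs 3, .nbrs 3, .nbrs 8, .isol 2 5, .nbrs 8, .isol 2 5,
    .isol 2 5, .nbrs 8, .isol 2 5, .isol 2 5, .nbrs 8, .nbrs 4, .isol 2 5, .isol 4 7, .isol 0 1,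
    .nbrs 3, .isol 2 5, .nbrs 3, .isol 2 5, .isol 3 6, .isol 0 1, .nbrs 4, .isol 2 5, .nbrs 3,
    .isol 3 6, .nbrs 3, .isol 0 1, .nbrs 2, .isol 0 1, .nbrs 3, .nbrs 4, .nbrs 2, .isol 0 1,
    .nbrs 3, .isol 0 1, .nbrs 2, .nbrs 4, .nbrs 2, .nbrs 3, .isol 0 1, .nbrs 2, .nbrs 3,
    .isol 0 1, .nbrs 2, .isol 0 1, .nbrs 3, .isol 0 1, .isol 2 5, .isol 0 1, .nbrs 3, .isol 0 1,
    .isol 0 1, .nbrs 3, .nbrs 3, .nbrs 8, .nbrs 2, .isol 0 1, .isol 0 1, .nbrs 3, .isol 0 1,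
    .nbrs 2, .isol 0 1, .nbrs 3, .nbrs 3, .isol 0 1, .nbrs 2, .isol 0 1, .nbrs 3, .isol 0 1,
    .isol 0 1, .nbrs 4, .isol 0 1, .nbrs 2, .isol 0 1, .isol 4 6, .isol 0 1, .nbrs 2, .isol 0 1,
    .isol 0 1, .nbrs 2, .nbrs 2, .nbrs 8, .nbrs 2, .isol 0 1, .nbrs 3, .nbrs 3, .isol 0 1,
    .nbrs 2, .isol 0 1, .nbrs 4, .nbrs 3, .nbrs 3, .isol 2 5, .isol 3 5, .nbrs 2, .nbrs 3,
    .isol 0 1, .isol 2 5, .isol 3 5, .isol 0 1, .nbrs 4, .isol 0 1, .isol 2 5, .nbrs 3,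
    .isol 3 5, .nbrs 2, .isol 2 5, .nbrs 3, .isol 3 5, .nbrs 3, .isol 0 1, .nbrs 2, .isol 0 1,
    .nbrs 3, .isol 0 1, .nbrs 2, .isol 2 6, .nbrs 3, .isol 3 6, .nbrs 3, .isol 0 1, .nbrs 2]

/-- A script that settles the graphs of minimum positive degree two. -/
def scriptDegreeTwo : List Move :=
  [.nbrs 1, .isol 0 1, .nbrs 3, .isol 0 1, .nbrs 2, .isol 0 1, .nbrs 2, .nbrs 2, .isol 3 6,
    .isol 0 2, .isol 0 1, .nbrs 2, .isol 0 2, .nbrs 2, .isol 0 2, .isol 0 1, .nbrs 3, .nbrs 3,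
    .isol 0 1, .nbrs 3, .nbrs 2, .isol 0 1, .nbrs 3, .nbrs 2, .isol 0 1, .isol 2 6, .isol 2 6,
    .nbrs 3, .nbrs 3, .isol 0 1, .nbrs 2, .isol 0 1, .isol 0 1, .isol 0 1, .nbrs 3, .isol 0 1]

/-- A script that settles the graphs of minimum positive degree three. -/
def scriptDegreeThree : List Move :=
  [.nbrs 1, .isol 0 1, .nbrs 3, .isol 0 3, .isol 0 3, .nbrs 5, .isol 1 5, .isol 1 5, .isol 0 1,
    .nbrs 4, .isol 0 1, .nbrs 2, .isol 0 1, .nbrs 5, .nbrs 2, .nbrs 2, .isol 2 7, .isol 0 3,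
    .isol 2 7, .isol 0 1, .isol 0 1, .isol 0 1, .isol 0 1, .isol 2 7, .isol 2 7, .isol 0 1,
    .isol 0 1, .isol 2 7, .nbrs 3, .isol 0 1, .nbrs 4, .nbrs 2, .nbrs 2, .nbrs 4, .isol 0 1,
    .nbrs 2, .isol 0 1, .nbrs 3, .isol 0 1, .nbrs 3, .nbrs 2, .isol 2 7, .isol 2 7, .isol 0 1,
    .isol 0 2, .isol 0 2, .isol 0 1, .nbrs 8, .isol 0 2, .nbrs 3, .isol 0 1, .nbrs 3, .isol 0 2,
    .isol 2 7, .isol 0 1]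

/-- A script that settles the graphs of minimum positive degree four. -/
def scriptDegreeFour : List Move :=
  [.nbrs 1, .isol 0 1, .nbrs 5, .isol 5 8, .nbrs 6, .isol 6 11, .isol 5 8, .isol 0 1, .isol 5 8,
    .nbrs 6, .isol 5 8, .isol 1 5, .isol 0 4, .isol 1 5, .isol 0 1, .isol 0 1, .nbrs 3,
    .isol 0 1, .nbrs 5, .isol 5 9, .nbrs 5, .nbrs 2, .isol 2 8, .isol 2 8, .nbrs 5, .isol 5 8,
    .isol 5 8, .nbrs 2, .isol 2 8, .isol 2 8, .nbrs 2, .isol 2 8, .isol 0 2, .isol 2 8, .nbrs 5,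
    .isol 0 2, .isol 1 5, .isol 5 8, .final, .isol 0 4, .nbrs 2, .isol 2 9, .nbrs 2, .nbrs 2,
    .isol 2 8, .isol 0 1, .isol 2 8, .nbrs 3, .isol 3 11, .isol 2 8, .nbrs 3, .isol 2 8,
    .isol 0 2, .isol 1 7, .isol 0 2, .isol 0 1, .isol 0 1, .nbrs 3, .isol 0 1, .nbrs 2, .nbrs 2,
    .isol 0 1, .nbrs 2, .isol 0 1]

set_option maxRecDepth 100000 in
theorem run_scriptDegreeOne : run 1 scriptDegreeOne [star 1] = true := by
  decide +kernel

set_option maxRecDepth 100000 in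
theorem run_scriptDegreeTwo : run 2 scriptDegreeTwo [star 2] = true := by
  decide +kernel

set_option maxRecDepth 100000 in
theorem run_scriptDegreeThree : run 3 scriptDegreeThree [star 3] = true := by
  decide +kernel

set_option maxRecDepth 100000 in
theorem run_scriptDegreeFour : run 4 scriptDegreeFour [star 4] = true := by
  decide +kernel

theorem exists_run_star {δ : ℕ} (h0 : 0 < δ) (h4 : δ ≤ 4) : ∃ ms, run δ ms [star δ] := by
  interval_cases δ
  exacts [⟨_, run_scriptDegreeOne⟩, ⟨_, run_scriptDegreeTwo⟩, ⟨_, run_scriptDegreeThree⟩,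
    ⟨_, run_scriptDegreeFour⟩]

end PartialGraph

/-! ### The greedy induced matching -/

universe u

namespace SimpleGraph

/-- Unless `G` contains an induced `C_5^2`, some edge `uv` can be taken into the matching at the
cost of at most `9` non-isolated vertices. -/
theorem exists_card_dominated_add_card_stranded_le {V : Type*} [Fintype V] [DecidableEq V]
    (G : SimpleGraph V) [DecidableRel G.Adj] (hdeg : ∀ v, G.degree v ≤ 4)
    (hfree : IsEmpty (blownUpFiveCycle ↪g G)) (hne : ∃ u v, G.Adj u v) :
    ∃ u v, G.Adj u v ∧ (G.dominated u v).card + (G.stranded u v).card ≤ 9 := by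
  by_contra! hno
  obtain ⟨a, b, hab⟩ := hne
  obtain ⟨r, hr, hmin⟩ := Finset.exists_min_image
    (Finset.univ.filter fun v => 0 < G.degree v) (fun v => G.degree v)
    ⟨a, by simpa using (G.degree_pos_iff_exists_adj a).2 ⟨b, hab⟩⟩
  have hr0 : 0 < G.degree r := (Finset.mem_filter.1 hr).2
  have hG : G.IsCritical (G.degree r) :=
    ⟨hr0, hdeg, fun v hv => hmin v (by simpa using hv), hno, hfree⟩
  obtain ⟨ms, hms⟩ := PartialGraph.exists_run_star hr0 (hdeg r)
  obtain ⟨φ, hφ⟩ := PartialGraph.Realizes.exists_star hG rfl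
  exact PartialGraph.Realizes.not_realizes_of_run hG ms hms _ (List.mem_singleton_self _) φ hφ

theorem IsInducedMatching.image {V W : Type*} [DecidableEq V] {G : SimpleGraph V}
    {H : SimpleGraph W} (f : H ↪g G) {M : Finset (Sym2 W)} (hM : H.IsInducedMatching M) :
    G.IsInducedMatching (M.image (Sym2.map f)) := by
  constructor
  · intro e he
    obtain ⟨e, heM, rfl⟩ := Finset.mem_image.1 he
    have := hM.1 e heM
    clear he heM
    induction e with
    | _ a b =>
    rw [Sym2.map_mk, mem_edgeSet]
    exact f.map_adj_iff.2 this
  · intro e he e' he' hne x hx y hy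
    obtain ⟨e, heM, rfl⟩ := Finset.mem_image.1 he
    obtain ⟨e', heM', rfl⟩ := Finset.mem_image.1 he'
    obtain ⟨x, hxe, rfl⟩ := Sym2.mem_map.1 hx
    obtain ⟨y, hye, rfl⟩ := Sym2.mem_map.1 hy
    have := hM.2 e heM e' heM' (fun h => hne (h ▸ rfl)) x hxe y hye
    exact ⟨f.injective.ne this.1, fun hadj => this.2 (f.map_adj_iff.1 hadj)⟩

theorem card_image_map_embedding {V W : Type*} [DecidableEq V] {G : SimpleGraph V}
    {H : SimpleGraph W} (f : H ↪g G) (M : Finset (Sym2 W)) :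
    (M.image (Sym2.map f)).card = M.card :=
  Finset.card_image_of_injective _ (Sym2.map.injective f.injective)

theorem IsInducedMatching.insert {V : Type*} [Fintype V] [DecidableEq V] {G : SimpleGraph V}
    [DecidableRel G.Adj] {M : Finset (Sym2 V)} (hM : G.IsInducedMatching M) {u v : V}
    (huv : G.Adj u v) (hMuv : ∀ e ∈ M, ∀ x ∈ e, x ∉ G.dominated u v) :
    G.IsInducedMatching (insert s(u, v) M) := by
  have key : ∀ e ∈ M, ∀ x ∈ s(u, v), ∀ y ∈ e, x ≠ y ∧ ¬ G.Adj x y := by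
    intro e he x hx y hy
    have hy := hMuv e he y hy
    simp only [dominated, Finset.mem_union, mem_neighborFinset, not_or] at hy
    rcases Sym2.mem_iff.1 hx with rfl | rfl
    · exact ⟨by rintro rfl; exact hy.2 huv.symm, hy.1⟩
    · exact ⟨by rintro rfl; exact hy.1 huv, hy.2⟩
  constructor
  · intro e he
    rcases Finset.mem_insert.1 he with rfl | he
    exacts [huv, hM.1 e he]
  · intro e he e' he' hne x hx y hy
    rcases Finset.mem_insert.1 he with rfl | he <;> rcases Finset.mem_insert.1 he' with rfl | he'
    · exact absurd rfl hne
    · exact key e' he' x hx y hy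
    · have := key e he y hy x hx
      exact ⟨this.1.symm, fun h => this.2 h.symm⟩
    · exact hM.2 e he e' he' hne x hx y hy

theorem numIsolated_eq_card {V : Type*} [Fintype V] [DecidableEq V] (G : SimpleGraph V)
    [DecidableRel G.Adj] : G.numIsolated = (Finset.univ.filter fun v => G.degree v = 0).card := by
  rw [numIsolated, Nat.subtype_card]
  intro v
  exact Finset.mem_filter_univ v |>.trans (G.degree_eq_zero v)

/-- Greedy choice: freeness is inherited by induced subgraphs, so an edge as in
`exists_card_dominated_add_card_stranded_le` is available as long as there are edges. -/
theorem exists_isInducedMatching_of_free (n : ℕ) :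
    ∀ (V : Type u) [Fintype V] (G : SimpleGraph V) [DecidableRel G.Adj],
      Fintype.card V = n → (∀ v, G.degree v ≤ 4) → IsEmpty (blownUpFiveCycle ↪g G) →
      ∃ M : Finset (Sym2 V), G.IsInducedMatching M ∧ n ≤ 9 * M.card + G.numIsolated := by
  classical
  induction n using Nat.strong_induction_on with
  | _ n ih =>
  intro V _ G _ hn hdeg hfree
  by_cases hne : ∃ u v, G.Adj u v
  · obtain ⟨u, v, huv, h9⟩ :=
      G.exists_card_dominated_add_card_stranded_le hdeg hfree hne
    let S : Set V := {x | x ∉ G.dominated u v}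
    let f : G.induce S ↪g G := Embedding.induce S
    have hu : u ∈ G.dominated u v := by simp [dominated, huv.symm]
    have hcard : Fintype.card S + (G.dominated u v).card = n := by
      rw [← hn, ← Finset.card_compl_add_card (G.dominated u v), Fintype.card_subtype]
      congr 2
      ext x
      simp [S]
    have hpos : 0 < (G.dominated u v).card := Finset.card_pos.2 ⟨u, hu⟩
    obtain ⟨M, hM, hle⟩ := ih (Fintype.card S) (by omega) S (G.induce S) rfl
      (fun x => (f.toCopy.degree_le x).trans (hdeg _))
      ⟨fun g => hfree.false (f.comp g)⟩
    have hMS : ∀ e ∈ M.image (Sym2.map f), ∀ x ∈ e, x ∉ G.dominated u v := by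
      intro e he x hx
      obtain ⟨e, -, rfl⟩ := Finset.mem_image.1 he
      obtain ⟨y, -, rfl⟩ := Sym2.mem_map.1 hx
      exact y.2
    refine ⟨insert s(u, v) (M.image (Sym2.map f)), (hM.image f).insert huv hMS, ?_⟩
    rw [Finset.card_insert_of_notMem
      (fun he => hMS _ he u (Sym2.mem_mk_left u v) hu), card_image_map_embedding]
    have hiso : (G.induce S).numIsolated ≤ G.numIsolated + (G.stranded u v).card := by
      rw [numIsolated_eq_card, numIsolated_eq_card,
        ← Finset.card_map (Function.Embedding.subtype (· ∈ S))]
      refine (Finset.card_le_card ?_).trans (Finset.card_union_le _ _)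
      intro x hx
      obtain ⟨y, hy, rfl⟩ := Finset.mem_map.1 hx
      replace hy := (Finset.mem_filter.1 hy).2
      rw [Finset.mem_union, Finset.mem_filter]
      by_cases h0 : G.degree y = 0
      · exact Or.inl ⟨Finset.mem_univ _, h0⟩
      · refine Or.inr (Finset.mem_filter.2 ⟨Finset.mem_univ _, y.2, Nat.pos_of_ne_zero h0, ?_⟩)
        intro z hz
        by_contra hzS
        have : 0 < (G.induce S).degree y :=
          ((G.induce S).degree_pos_iff_exists_adj y).2 ⟨⟨z, hzS⟩, hz⟩
        omega
    omega
  · push Not at hne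
    refine ⟨∅, ⟨by simp, by simp⟩, ?_⟩
    rw [numIsolated_eq_card, Finset.filter_true_of_mem, Finset.card_univ, hn]
    · simp
    · intro v _
      by_contra h0
      obtain ⟨w, hw⟩ := (G.degree_pos_iff_exists_adj v).1 (Nat.pos_of_ne_zero h0)
      exact hne v w hw

end SimpleGraph

/-! ### Components isomorphic to the blown-up five-cycle -/

namespace SimpleGraph

theorem blownUpFiveCycle_adj {p q : Fin 5 × Fin 2} :
    blownUpFiveCycle.Adj p q ↔ p.1 - q.1 = 1 ∨ q.1 - p.1 = 1 :=
  Iff.rfl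

theorem blownUpFiveCycle_reachable (p q : Fin 5 × Fin 2) : blownUpFiveCycle.Reachable p q := by
  have h : ∀ p q : Fin 5 × Fin 2, (p.1 - q.1 = 1 ∨ q.1 - p.1 = 1) ∨
      ∃ r : Fin 5 × Fin 2, (p.1 - r.1 = 1 ∨ r.1 - p.1 = 1) ∧ (r.1 - q.1 = 1 ∨ q.1 - r.1 = 1) := by
    decide +kernel
  rcases h p q with h | ⟨r, h1, h2⟩
  · exact Adj.reachable (blownUpFiveCycle_adj.2 h)
  · exact (Adj.reachable (blownUpFiveCycle_adj.2 h1)).trans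
      (Adj.reachable (blownUpFiveCycle_adj.2 h2))

theorem card_blownUpFiveCycle_neighbors (p : Fin 5 × Fin 2) :
    (Finset.univ.filter fun q : Fin 5 × Fin 2 => p.1 - q.1 = 1 ∨ q.1 - p.1 = 1).card = 4 := by
  revert p
  decide +kernel

theorem ConnectedComponent.IsBlownUpFiveCycle.exists_adj_ne {V : Type*} {G : SimpleGraph V}
    {C : G.ConnectedComponent} (hC : C.IsBlownUpFiveCycle) {x : V} (hx : x ∈ C.supp) (r : V) :
    ∃ y ∈ C.supp, G.Adj x y ∧ y ≠ r := by
  obtain ⟨e⟩ := hC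
  have h : ∀ p : Fin 5 × Fin 2, ∃ q q' : Fin 5 × Fin 2, q ≠ q' ∧
      (p.1 - q.1 = 1 ∨ q.1 - p.1 = 1) ∧ (p.1 - q'.1 = 1 ∨ q'.1 - p.1 = 1) := by
    decide +kernel
  obtain ⟨q, q', hne, h1, h2⟩ := h (e ⟨x, hx⟩)
  have hadj : ∀ q, blownUpFiveCycle.Adj (e ⟨x, hx⟩) q → G.Adj x (e.symm q) := by
    intro q hq
    have := e.symm.map_adj_iff.2 hq
    rw [RelIso.symm_apply_apply] at this
    exact this
  by_cases hr : (e.symm q : V) = r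
  · refine ⟨e.symm q', (e.symm q').2, hadj q' h2, fun hr' => hne ?_⟩
    exact e.symm.injective (Subtype.ext (hr.trans hr'.symm))
  · exact ⟨e.symm q, (e.symm q).2, hadj q h1, hr⟩

variable {V : Type*} [Fintype V] {G : SimpleGraph V} [DecidableRel G.Adj]

/-- `C_5^2` is `4`-regular, so no edge leaves an induced copy of it. -/
theorem exists_of_adj_blownUpFiveCycle (hdeg : ∀ v, G.degree v ≤ 4) (g : blownUpFiveCycle ↪g G)
    {p : Fin 5 × Fin 2} {w : V} (hw : G.Adj (g p) w) : ∃ q, g q = w := by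
  have hsub : (Finset.univ.filter fun q : Fin 5 × Fin 2 =>
      p.1 - q.1 = 1 ∨ q.1 - p.1 = 1).map g.toEmbedding ⊆ G.neighborFinset (g p) := by
    intro x hx
    obtain ⟨q, hq, rfl⟩ := Finset.mem_map.1 hx
    rw [mem_neighborFinset]
    exact g.map_adj_iff.2 (blownUpFiveCycle_adj.2 (Finset.mem_filter.1 hq).2)
  have heq := Finset.eq_of_subset_of_card_le hsub (by
    rw [Finset.card_map, card_blownUpFiveCycle_neighbors, card_neighborFinset_eq_degree]
    exact hdeg _)
  have : w ∈ G.neighborFinset (g p) := (mem_neighborFinset _ _ _).2 hw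
  rw [← heq] at this
  obtain ⟨q, -, rfl⟩ := Finset.mem_map.1 this
  exact ⟨q, rfl⟩

/-- An induced copy of `C_5^2` is a whole component. -/
theorem mem_supp_iff_exists_blownUpFiveCycle (hdeg : ∀ v, G.degree v ≤ 4)
    (g : blownUpFiveCycle ↪g G) (w : V) :
    w ∈ (G.connectedComponentMk (g (0, 0))).supp ↔ ∃ q, g q = w := by
  rw [ConnectedComponent.mem_supp_iff, ConnectedComponent.eq]
  constructor
  · rintro ⟨walk⟩
    have : ∀ (a b : V) (p : G.Walk a b), (∃ q, g q = b) → ∃ q, g q = a := by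
      intro a b p
      induction p with
      | nil => exact id
      | cons hadj _ ih =>
        intro hb
        obtain ⟨q, rfl⟩ := ih hb
        exact exists_of_adj_blownUpFiveCycle hdeg g hadj.symm
    exact this _ _ walk ⟨_, rfl⟩
  · rintro ⟨q, rfl⟩
    exact (blownUpFiveCycle_reachable q (0, 0)).map g.toHom

theorem isBlownUpFiveCycle_of_embedding (hdeg : ∀ v, G.degree v ≤ 4)
    (g : blownUpFiveCycle ↪g G) : (G.connectedComponentMk (g (0, 0))).IsBlownUpFiveCycle := by
  have hmem := mem_supp_iff_exists_blownUpFiveCycle hdeg g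
  let e : Fin 5 × Fin 2 → (G.connectedComponentMk (g (0, 0))) := fun p => ⟨g p, (hmem _).2 ⟨p, rfl⟩⟩
  have he : Function.Bijective e := by
    refine ⟨fun p q h => g.injective (congrArg Subtype.val h), ?_⟩
    rintro ⟨w, hw⟩
    obtain ⟨q, rfl⟩ := (hmem w).1 hw
    exact ⟨q, rfl⟩
  exact ⟨Iso.symm ⟨Equiv.ofBijective e he, g.map_adj_iff⟩⟩

/-- Deleting one vertex from each component isomorphic to `C_5^2` leaves a graph without induced
`C_5^2`, and it isolates no vertex because such components are `4`-regular. -/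
theorem card_le_strongMatchingNumber (hdeg : ∀ v, G.degree v ≤ 4) :
    Fintype.card V ≤ 9 * G.strongMatchingNumber + G.numIsolated + G.numBlownUpFiveCycles := by
  classical
  let B := {C : G.ConnectedComponent // C.IsBlownUpFiveCycle}
  choose rep hrep using fun C : B => C.1.exists_rep
  let S : Set V := {x | x ∉ Set.range rep}
  let f : G.induce S ↪g G := Embedding.induce S
  have hfree : IsEmpty (blownUpFiveCycle ↪g G.induce S) := by
    refine ⟨fun g => ?_⟩
    let C : B := ⟨_, isBlownUpFiveCycle_of_embedding hdeg (f.comp g)⟩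
    obtain ⟨q, hq⟩ := (mem_supp_iff_exists_blownUpFiveCycle hdeg (f.comp g) (rep C)).1 (hrep C)
    exact (g q).2 ⟨C, hq.symm⟩
  obtain ⟨M, hM, hle⟩ := exists_isInducedMatching_of_free _ S (G.induce S) rfl
    (fun x => (f.toCopy.degree_le x).trans (hdeg _)) hfree
  have hν : M.card ≤ G.strongMatchingNumber :=
    G.isGreatest_strongMatchingNumber.2 ⟨_, hM.image f, card_image_map_embedding f M⟩
  have hcard : Fintype.card V ≤ Fintype.card S + G.numBlownUpFiveCycles := by
    have h1 : Fintype.card S = (Finset.univ.image rep)ᶜ.card := by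
      rw [Fintype.card_subtype]
      congr 1
      ext x
      simp [S]
    have h2 : (Finset.univ.image rep).card ≤ G.numBlownUpFiveCycles := by
      rw [numBlownUpFiveCycles, Nat.card_eq_fintype_card]
      exact Finset.card_image_le
    have h3 := Finset.card_compl_add_card (Finset.univ.image rep)
    omega
  have hiso : (G.induce S).numIsolated ≤ G.numIsolated := by
    rw [numIsolated_eq_card, numIsolated_eq_card,
      ← Finset.card_map (Function.Embedding.subtype (· ∈ S))]
    refine Finset.card_le_card fun x hx => ?_
    obtain ⟨y, hy, rfl⟩ := Finset.mem_map.1 hx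
    replace hy := (Finset.mem_filter.1 hy).2
    refine Finset.mem_filter.2 ⟨Finset.mem_univ _, ?_⟩
    by_contra h0
    obtain ⟨z, hz⟩ := (G.degree_pos_iff_exists_adj _).1 (Nat.pos_of_ne_zero h0)
    have hno : ∀ w, G.Adj y w → ∃ C, rep C = w := by
      intro w hw
      by_contra hwS
      have : 0 < (G.induce S).degree y :=
        ((G.induce S).degree_pos_iff_exists_adj y).2 ⟨⟨w, hwS⟩, hw⟩
      omega
    obtain ⟨C, rfl⟩ := hno z hz
    have hyC : (y : V) ∈ C.1.supp :=
      (ConnectedComponent.connectedComponentMk_eq_of_adj hz).trans (hrep C)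
    obtain ⟨w, hwC, hw, hne⟩ := C.2.exists_adj_ne hyC (rep C)
    obtain ⟨D, rfl⟩ := hno w hw
    exact hne (congrArg rep (Subtype.ext ((hrep D).symm.trans hwC)))
  omega

end SimpleGraph

theorem theorem1 {V : Type*} [Fintype V] (G : SimpleGraph V) [DecidableRel G.Adj]
    (hG : G.maxDegree ≤ 4) :
    ((Fintype.card V : ℚ) - (G.numIsolated : ℚ) - (G.numBlownUpFiveCycles : ℚ)) / 9
        ≤ (G.strongMatchingNumber : ℚ) ∧
      ((∀ v : V, ¬ G.IsIsolated v) →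
        (∀ C : G.ConnectedComponent, ¬ C.IsBlownUpFiveCycle) →
        (Fintype.card V : ℚ) / 9 ≤ (G.strongMatchingNumber : ℚ)) := by
  have h := SimpleGraph.card_le_strongMatchingNumber fun v => (G.degree_le_maxDegree v).trans hG
  constructor
  · have h' : (Fintype.card V : ℚ) ≤
        9 * G.strongMatchingNumber + G.numIsolated + G.numBlownUpFiveCycles := by exact_mod_cast h
    linarith
  · intro hi hC
    have h0 : G.numIsolated = 0 := by
      have : IsEmpty {v : V // G.IsIsolated v} := ⟨fun v => hi v.1 v.2⟩
      exact Nat.card_of_isEmpty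
    have h5 : G.numBlownUpFiveCycles = 0 := by
      have : IsEmpty {C : G.ConnectedComponent // C.IsBlownUpFiveCycle} := ⟨fun C => hC C.1 C.2⟩
      exact Nat.card_of_isEmpty
    rw [h0, h5] at h
    have h' : (Fintype.card V : ℚ) ≤ 9 * G.strongMatchingNumber := by exact_mod_cast h
    linarith
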